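/- Consider $n$ links and $c$ channels, with a conflict graph $G$ on the links. A configuration $M\in\{0,1\}^{n\times c}$ is feasible if every link uses at most one channel ($\sum_j M_{ij}\le 1$ for all $i$) and no two links adjacent in $G$ use the same channel; let $\mathcal M$ be the set of feasible configurations. Let $\Theta=[0,1]^{n\times c}$. Under parameter $\theta\in\Theta$, the rewards $r_{ij}(t)$ (one packet per slot) are Bernoulli variables of mean $\theta_{ij}$, independent over $i,j$ and over the slots $t\ge 1$. Write $r_M(t)=\sum_{i,j}M_{ij}r_{ij}(t)$, $\mu^M(\theta)=\sum_{i,j}M_{ij}\theta_{ij}$ and $\mu^\star=\max_{M\in\mathcal M}\mu^M(\theta)$. A policy $\pi$ with aggregate feedback selects in each slot $t$ a configuration $M^\pi(t)\in\mathcal M$, possibly at random, according to a distribution that depends only on the past selections $M^\pi(s)$ and the past total rewards $r_{M^\pi(s)}(s)$, $s<t$. Its regret is $R^\pi(T)=\max_{M\in\mathcal M}\mathbb E[\sum_{t=1}^T r_M(t)]-\mathbb E[\sum_{t=1}^T r_{M^\pi(t)}(t)]$. The policy is uniformly good if for every $\theta\in\Theta$ with a unique optimal configuration $M^\star$ and every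 $M\in\mathcal M$, $M\ne M^\star$, the number $T_M(T)$ of slots among the first $T$ in which $M$ is selected satisfies $\mathbb E[T_M(T)]=o(T^\gamma)$ as $T\to\infty$, for all $\gamma>0$. For $M\in\mathcal M$ and $k=0,\dots,n$ let $\mathcal A_M=\{(i,j):M_{ij}=1\}$ and $$p(k;M,\theta)=\sum_{A\subset\mathcal A_M,\,|A|=k}\ \prod_{(i,j)\in A}\theta_{ij}\prod_{(i,j)\in\mathcal A_M\setminus A}(1-\theta_{ij}),\qquad KL_2^M(\theta,\lambda)=\sum_{k=0}^n p(k;M,\theta)\log\frac{p(k;M,\theta)}{p(k;M,\lambda)}\in[0,\infty],$$ with the usual conventions $0\log(0/q)=0$ and $p\log(p/0)=\infty$ for $p>0$. Theorem. Let $\theta\in\Theta$ have a unique optimal configuration $M^\star$. For $M\in\mathcal M$ put $B_M(\theta)=\{\lambda\in\Theta:\ \lambda_{ij}=\theta_{ij}\text{ whenever }M^\star_{ij}=1,\ \text{and } \mu^\star<\mu^M(\lambda)\}$. Then every uniformly good policy $\pi$ with aggregate feedback satisfies $$\liminf_{T\to\infty}\frac{R^\pi(T)}{\log T}\ \ge\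 C_2(\theta),$$ where $C_2(\theta)$ is the value of the optimization problem $$\inf_{x_M\ge 0,\,M\in\mathcal M}\ \sum_{M\in\mathcal M}x_M\,(\mu^\star-\mu^M(\theta))\quad\text{subject to}\quad \inf_{\lambda\in B_M(\theta)}\ \sum_{Q\in\mathcal M,\,Q\ne M^\star}x_Q\,KL_2^Q(\theta,\lambda)\ \ge 1\quad\text{for all }M\in\mathcal M,\ M\ne M^\star,$$ with $0\cdot\infty=0$ and the infimum over the empty set equal to $+\infty$. -/

import Mathlib

open Filter Topology Asymptotics

namespace SpectrumBandit

noncomputable section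

/-- A 0-1 matrix: `M i j = true` iff link `i` uses channel `j`. -/
abbrev Config (n c : ℕ) : Type := Fin n → Fin c → Bool

/-- The 0-1 matrix of packet transmissions in a slot: `y i j = true` iff the packet sent on link `i`
and channel `j` would be successful (`r_ij(t) = 1`). -/
abbrev Outcome (n c : ℕ) : Type := Fin n → Fin c → Bool

/-- Feasibility for the conflict graph `G`: every link uses at most one channel, and two interfering
links never use the same channel. -/
def Feasible {n c : ℕ} (G : SimpleGraph (Fin n)) (M : Config n c) : Prop :=
  (∀ i, ∑ j, (M i j).toNat ≤ 1) ∧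
    ∀ i i', G.Adj i i' → ∀ j, (M i j).toNat * (M i' j).toNat = 0

instance {n c : ℕ} (G : SimpleGraph (Fin n)) (M : Config n c) : Decidable (Feasible G M) :=
  Classical.propDecidable _

/-- The finite set of feasible configurations. -/
abbrev FeasibleConfig {n : ℕ} (G : SimpleGraph (Fin n)) (c : ℕ) : Type :=
  {M : Config n c // Feasible G M}

/-- The parameter set `[0,1]^{n × c}`. -/
def paramSet (n c : ℕ) : Set (Fin n → Fin c → ℝ) :=
  {θ | ∀ i j, 0 ≤ θ i j ∧ θ i j ≤ 1}

/-- The mean reward `μ^M(θ) = M • θ` of configuration `M`. -/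
def mean {n c : ℕ} (M : Config n c) (θ : Fin n → Fin c → ℝ) : ℝ :=
  ∑ i, ∑ j, ((M i j).toNat : ℝ) * θ i j

/-- The optimal mean reward `μ⋆ = max_M μ^M(θ)` over the (finite, nonempty) set of feasible
configurations. -/
def optMean {n c : ℕ} (G : SimpleGraph (Fin n)) (θ : Fin n → Fin c → ℝ) : ℝ :=
  ⨆ M : FeasibleConfig G c, mean M.1 θ

/-- `Mstar` is the unique optimal static configuration under `θ`. -/
def IsUniqueOptimal {n c : ℕ} {G : SimpleGraph (Fin n)} (θ : Fin n → Fin c → ℝ)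
    (Mstar : FeasibleConfig G c) : Prop :=
  ∀ M : FeasibleConfig G c, M ≠ Mstar → mean M.1 θ < mean Mstar.1 θ

/-- The total reward `r_M(t) = M • r(t)` collected by `M` in a slot with outcome matrix `y`. -/
def reward {n c : ℕ} (M : Config n c) (y : Outcome n c) : ℕ :=
  ∑ i, ∑ j, (M i j).toNat * (y i j).toNat

/-! ### Policies with aggregate feedback and the law of the process -/

/-- A (randomized) policy with aggregate feedback: given the configurations selected in the past
slots and the total rewards they produced, a distribution from which the next configuration is
sampled. -/
abbrev Policy {n : ℕ} (G : SimpleGraph (Fin n)) (c : ℕ) : Type :=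
  (t : ℕ) → (Fin t → FeasibleConfig G c × ℕ) → PMF (FeasibleConfig G c)

/-- A trajectory over `T` slots: in each slot, the selected configuration and the outcome matrix. -/
abbrev Trajectory {n : ℕ} (G : SimpleGraph (Fin n)) (c T : ℕ) : Type :=
  Fin T → FeasibleConfig G c × Outcome n c

/-- What the decision maker has seen before slot `t`: past configurations and total rewards. -/
def observed {n c T : ℕ} {G : SimpleGraph (Fin n)} (ω : Trajectory G c T) (t : Fin T) :
    Fin t.1 → FeasibleConfig G c × ℕ :=
  fun s => ((ω (s.castLE t.2.le)).1, reward (ω (s.castLE t.2.le)).1.1 (ω (s.castLE t.2.le)).2)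

/-- Probability of an outcome matrix with independent Bernoulli entries of means `θ i j`. -/
def outcomeProb {n c : ℕ} (θ : Fin n → Fin c → ℝ) (y : Outcome n c) : ℝ :=
  ∏ i, ∏ j, if y i j then θ i j else 1 - θ i j

/-- Probability of a trajectory of the first `T` slots: in each slot the configuration is sampled
from the policy's distribution given the observations so far, and the outcome matrix is drawn
independently of the past and of the selected configuration. -/
def trajProb {n c : ℕ} {G : SimpleGraph (Fin n)} (π : Policy G c) (θ : Fin n → Fin c → ℝ) {T : ℕ}
    (ω : Trajectory G c T) : ℝ :=
  ∏ t : Fin T, (π t.1 (observed ω t) (ω t).1).toReal * outcomeProb θ (ω t).2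

/-- Expectation, under policy `π` and parameter `θ`, of a function of the first `T` slots. -/
def expect {n c : ℕ} {G : SimpleGraph (Fin n)} (π : Policy G c) (θ : Fin n → Fin c → ℝ) {T : ℕ}
    (f : Trajectory G c T → ℝ) : ℝ :=
  ∑ ω : Trajectory G c T, trajProb π θ ω * f ω

/-- The regret `R^π(T) = max_M E[∑_{t ≤ T} r_M(t)] - E[∑_{t ≤ T} r_{M^π(t)}(t)]`. -/
def regret {n c : ℕ} {G : SimpleGraph (Fin n)} (π : Policy G c) (θ : Fin n → Fin c → ℝ)
    (T : ℕ) : ℝ :=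
  (⨆ M : FeasibleConfig G c,
      expect π θ (fun ω : Trajectory G c T => ∑ t, (reward M.1 (ω t).2 : ℝ))) -
    expect π θ (fun ω : Trajectory G c T => ∑ t, (reward (ω t).1.1 (ω t).2 : ℝ))

/-- `T_M`: the number of slots of the trajectory in which `M` is selected. -/
def selectionCount {n c T : ℕ} {G : SimpleGraph (Fin n)} (M : FeasibleConfig G c)
    (ω : Trajectory G c T) : ℕ :=
  (Finset.univ.filter fun t : Fin T => (ω t).1 = M).card

/-- Uniformly good policies: for every parameter (with a unique optimal configuration), each
suboptimal configuration satisfies `E[T_M(T)] = o(T^γ)` for all `γ > 0`. -/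
def UniformlyGood {n c : ℕ} {G : SimpleGraph (Fin n)} (π : Policy G c) : Prop :=
  ∀ θ ∈ paramSet n c, ∀ Mstar : FeasibleConfig G c, IsUniqueOptimal θ Mstar →
    ∀ M : FeasibleConfig G c, M ≠ Mstar → ∀ γ : ℝ, 0 < γ →
      (fun T : ℕ => expect π θ (fun ω : Trajectory G c T => (selectionCount M ω : ℝ)))
        =o[atTop] fun T : ℕ => (T : ℝ) ^ γ

/-! ### The constant in the lower bound -/

/-- The set `{(i,j) : ∑_l M_il = M_ij = 1}` of active (link, channel) pairs. -/
def activePairs {n c : ℕ} (M : Config n c) : Finset (Fin n × Fin c) :=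
  Finset.univ.filter fun p => ∑ l, (M p.1 l).toNat = 1 ∧ (M p.1 p.2).toNat = 1

/-- The Poisson-binomial probability that the total reward under `M` and `θ` equals `k`. -/
def aggProb {n c : ℕ} (k : ℕ) (M : Config n c) (θ : Fin n → Fin c → ℝ) : ℝ :=
  ∑ A ∈ (activePairs M).powersetCard k,
    (∏ p ∈ A, θ p.1 p.2) * ∏ p ∈ activePairs M \ A, (1 - θ p.1 p.2)

/-- The divergence `∑_{k=0}^n p(k;M,θ) log (p(k;M,θ) / p(k;M,lam))` of the laws of the total reward
under `M`, with the conventions `0 log (0/q) = 0` and `p log (p/0) = ∞` for `p > 0`. -/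
def aggKL {n c : ℕ} (M : Config n c) (θ lam : Fin n → Fin c → ℝ) : EReal :=
  ∑ k ∈ Finset.range (n + 1),
    if aggProb k M θ = 0 then 0
    else if aggProb k M lam = 0 then ⊤
    else ((aggProb k M θ * Real.log (aggProb k M θ / aggProb k M lam) : ℝ) : EReal)

/-- The set `B_M(θ)` of parameters that agree with `θ` on the pairs used by `Mstar` and under which
the mean reward of `M` exceeds `μ⋆`. -/
def badSet {n c : ℕ} {G : SimpleGraph (Fin n)} (θ : Fin n → Fin c → ℝ)
    (Mstar M : FeasibleConfig G c) : Set (Fin n → Fin c → ℝ) :=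
  {lam | lam ∈ paramSet n c ∧ (∀ i j, Mstar.1 i j = true → lam i j = θ i j) ∧
    optMean G θ < mean M.1 lam}

/-- The feasible weights of the optimization problem: `x_M ≥ 0` for all `M`, and for all
`M ≠ Mstar`, `inf_{lam ∈ B_M(θ)} ∑_{Q ≠ Mstar} x_Q KL₂^Q(θ, lam) ≥ 1`
(an infimum over the empty set is `∞`). -/
def admissibleWeights {n c : ℕ} {G : SimpleGraph (Fin n)} (θ : Fin n → Fin c → ℝ)
    (Mstar : FeasibleConfig G c) : Set (FeasibleConfig G c → ℝ) :=
  {x | (∀ M, 0 ≤ x M) ∧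
    ∀ M, M ≠ Mstar →
      1 ≤ ⨅ lam ∈ badSet θ Mstar M,
        ∑ Q ∈ Finset.univ.filter (fun Q => Q ≠ Mstar), (x Q : EReal) * aggKL Q.1 θ lam}

/-- `C₂(θ)`: the infimum of `∑_M x_M (μ⋆ - μ^M(θ))` over the admissible weights. -/
def lowerBoundConst {n c : ℕ} {G : SimpleGraph (Fin n)} (θ : Fin n → Fin c → ℝ)
    (Mstar : FeasibleConfig G c) : EReal :=
  ⨅ x ∈ admissibleWeights θ Mstar,
    ((∑ M : FeasibleConfig G c, x M * (optMean G θ - mean M.1 θ) : ℝ) : EReal)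

end

end SpectrumBandit

namespace SpectrumBandit

/-! ### The horizon recursion -/

/-! Write N for the optimal configuration `Mstar`. By a Wald identity, the regret is the sum over M
of E[T_M(T)] times the gap of M (`regret_eq`). If the liminf of regret / log T were below some r <
C₂(θ), then along a suitable ultrafilter the vectors E[T_Q(T)] / log T, Q ≠ N, would stay in a
compact box and converge. The limit costs at most r, so a contradiction follows once it is an
admissible weight vector (`lowerBoundConst_le_of_frequently`).

Admissibility is a change of measure. The observations of T slots carry the information Σ_Q E_θ[T_Q]
KL_Q(θ, lam), which bounds E_θ[f] - (E_lam[exp f] - 1) for every function f of the observations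
(`expect_sub_expect_exp_le`). Take f = (1-γ) log T · T_N / T. Under θ, N is played almost always;
under an alternative whose unique optimum is another configuration, E_lam[T_N] = o(T^γ). Hence the
information is at least (1 - γ - o(1)) log T. The slots playing N contribute none, because lam and θ
agree on N (`one_le_sum_limit_mul_realKL`).

A parameter of `badSet` may have ties, and may lie on the boundary of the cube, where absolute
continuity can fail. It is therefore approached by generic interior perturbations off N
(`eventually_perturb_badSet`). The constraint passes to the limit by continuity of the divergence,
unless a positively weighted divergence is infinite, when the constraint is trivial
(`mem_admissibleWeights_of_tendsto`). -/

/-- All observations made along a trajectory: selected configurations and total rewards. -/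
def history {n c T : ℕ} {G : SimpleGraph (Fin n)} (ω : Trajectory G c T) :
    Fin T → FeasibleConfig G c × ℕ :=
  fun s => ((ω s).1, reward (ω s).1.1 (ω s).2)

/-- A trajectory extended by one slot. -/
def extend {n c T : ℕ} {G : SimpleGraph (Fin n)} (ω : Trajectory G c T)
    (z : FeasibleConfig G c × Outcome n c) : Trajectory G c (T + 1) :=
  Fin.snoc (α := fun _ => FeasibleConfig G c × Outcome n c) ω z

section

variable {n c : ℕ} {G : SimpleGraph (Fin n)}

@[simp] lemma extend_castSucc {T : ℕ} (ω : Trajectory G c T)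
    (z : FeasibleConfig G c × Outcome n c) (t : Fin T) : extend ω z t.castSucc = ω t := by
  simp [extend]

@[simp] lemma extend_last {T : ℕ} (ω : Trajectory G c T)
    (z : FeasibleConfig G c × Outcome n c) : extend ω z (Fin.last T) = z := by
  simp [extend]

lemma history_extend {T : ℕ} (ω : Trajectory G c T) (z : FeasibleConfig G c × Outcome n c) :
    history (extend ω z) = Fin.snoc (α := fun _ => FeasibleConfig G c × ℕ) (history ω)
      (z.1, reward z.1.1 z.2) := by
  funext s
  refine Fin.lastCases ?_ (fun t => ?_) s <;> simp [history]

lemma observed_extend_castSucc {T : ℕ} (ω : Trajectory G c T)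
    (z : FeasibleConfig G c × Outcome n c) (t : Fin T) :
    observed (extend ω z) t.castSucc = observed ω t := by
  funext s
  have h : (Fin.castLE (Fin.castSucc t).2.le s : Fin (T + 1)) = (Fin.castLE t.2.le s).castSucc :=
    rfl
  simp only [observed, h, extend_castSucc]

lemma observed_extend_last {T : ℕ} (ω : Trajectory G c T)
    (z : FeasibleConfig G c × Outcome n c) :
    observed (extend ω z) (Fin.last T) = history ω := by
  funext s
  have h : (Fin.castLE (Fin.last T).2.le s : Fin (T + 1)) = Fin.castSucc s := rfl
  simp only [observed, history, h, extend_castSucc]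

lemma trajProb_extend (π : Policy G c) (θ : Fin n → Fin c → ℝ) {T : ℕ} (ω : Trajectory G c T)
    (z : FeasibleConfig G c × Outcome n c) :
    trajProb π θ (extend ω z) =
      trajProb π θ ω * ((π T (history ω) z.1).toReal * outcomeProb θ z.2) := by
  unfold trajProb
  rw [Fin.prod_univ_castSucc]
  simp only [extend_castSucc, extend_last, observed_extend_castSucc]
  congr 3
  rw [← observed_extend_last ω z]
  rfl

lemma expect_succ (π : Policy G c) (θ : Fin n → Fin c → ℝ) {T : ℕ}
    (f : Trajectory G c (T + 1) → ℝ) :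
    expect π θ f = expect π θ fun ω : Trajectory G c T =>
      ∑ M, (π T (history ω) M).toReal * ∑ y, outcomeProb θ y * f (extend ω (M, y)) := by
  unfold expect
  rw [← (Fin.snocEquiv fun _ : Fin (T + 1) => FeasibleConfig G c × Outcome n c).sum_comp,
    Fintype.sum_prod_type_right]
  refine Finset.sum_congr rfl fun ω _ => ?_
  rw [Fintype.sum_prod_type, Finset.mul_sum]
  refine Finset.sum_congr rfl fun M _ => ?_
  rw [Finset.mul_sum, Finset.mul_sum]
  refine Finset.sum_congr rfl fun y _ => ?_
  have h : (Fin.snocEquiv fun _ : Fin (T + 1) => FeasibleConfig G c × Outcome n c) ((M, y), ω) =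
    extend ω (M, y) := rfl
  rw [h, trajProb_extend]
  ring

/-! ### Positivity and linearity of the expectation -/

lemma outcomeProb_nonneg {θ : Fin n → Fin c → ℝ} (hθ : θ ∈ paramSet n c) (y : Outcome n c) :
    0 ≤ outcomeProb θ y :=
  Finset.prod_nonneg fun i _ => Finset.prod_nonneg fun j _ => by
    have := hθ i j
    split_ifs <;> linarith

lemma trajProb_nonneg (π : Policy G c) {θ : Fin n → Fin c → ℝ} (hθ : θ ∈ paramSet n c) {T : ℕ}
    (ω : Trajectory G c T) : 0 ≤ trajProb π θ ω :=
  Finset.prod_nonneg fun _ _ => mul_nonneg ENNReal.toReal_nonneg (outcomeProb_nonneg hθ _)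

lemma expect_mono (π : Policy G c) {θ : Fin n → Fin c → ℝ} (hθ : θ ∈ paramSet n c) {T : ℕ}
    {f g : Trajectory G c T → ℝ} (h : ∀ ω, f ω ≤ g ω) : expect π θ f ≤ expect π θ g :=
  Finset.sum_le_sum fun ω _ => mul_le_mul_of_nonneg_left (h ω) (trajProb_nonneg π hθ ω)

lemma expect_nonneg (π : Policy G c) {θ : Fin n → Fin c → ℝ} (hθ : θ ∈ paramSet n c) {T : ℕ}
    {f : Trajectory G c T → ℝ} (h : ∀ ω, 0 ≤ f ω) : 0 ≤ expect π θ f :=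
  Finset.sum_nonneg fun ω _ => mul_nonneg (trajProb_nonneg π hθ ω) (h ω)

lemma expect_add (π : Policy G c) (θ : Fin n → Fin c → ℝ) {T : ℕ} (f g : Trajectory G c T → ℝ) :
    expect π θ (fun ω => f ω + g ω) = expect π θ f + expect π θ g := by
  simp [expect, mul_add, Finset.sum_add_distrib]

lemma expect_sub (π : Policy G c) (θ : Fin n → Fin c → ℝ) {T : ℕ} (f g : Trajectory G c T → ℝ) :
    expect π θ (fun ω => f ω - g ω) = expect π θ f - expect π θ g := by
  simp [expect, mul_sub, Finset.sum_sub_distrib]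

lemma expect_const_mul (π : Policy G c) (θ : Fin n → Fin c → ℝ) {T : ℕ} (a : ℝ)
    (f : Trajectory G c T → ℝ) : expect π θ (fun ω => a * f ω) = a * expect π θ f := by
  simp only [expect, Finset.mul_sum]
  exact Finset.sum_congr rfl fun _ _ => by ring

lemma expect_mul_const (π : Policy G c) (θ : Fin n → Fin c → ℝ) {T : ℕ} (a : ℝ)
    (f : Trajectory G c T → ℝ) : expect π θ (fun ω => f ω * a) = expect π θ f * a := by
  simp only [mul_comm _ a, expect_const_mul]

lemma expect_sum (π : Policy G c) (θ : Fin n → Fin c → ℝ) {T : ℕ} {ι : Type*} (s : Finset ι)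
    (f : ι → Trajectory G c T → ℝ) :
    expect π θ (fun ω => ∑ i ∈ s, f i ω) = ∑ i ∈ s, expect π θ (f i) := by
  simp only [expect, Finset.mul_sum]
  exact Finset.sum_comm

lemma sum_policy_eq_one {T : ℕ} (π : Policy G c) (h : Fin T → FeasibleConfig G c × ℕ) :
    ∑ M, (π T h M).toReal = 1 := by
  rw [← ENNReal.toReal_sum fun M _ => PMF.apply_ne_top _ _,
    ← tsum_fintype (L := .unconditional _), PMF.tsum_coe, ENNReal.toReal_one]

/-! ### Sums over outcome matrices -/

/-- Distributivity, applied to the rows and then to the entries. A general semiring is allowed so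
that it also serves for generating functions. -/
lemma sum_outcome_prod {R : Type*} [CommSemiring R] (w : Fin n → Fin c → Bool → R) :
    ∑ y : Outcome n c, ∏ i, ∏ j, w i j (y i j) = ∏ i, ∏ j, (w i j true + w i j false) := by
  have h1 : ∀ i, ∏ j, (w i j true + w i j false) = ∑ z : Fin c → Bool, ∏ j, w i j (z j) := by
    intro i
    have := Finset.prod_univ_sum (fun _ : Fin c => (Finset.univ : Finset Bool)) (w i)
    rw [Fintype.piFinset_univ] at this
    simpa only [Fintype.sum_bool] using this
  simp only [h1]
  have := Finset.prod_univ_sum (fun _ : Fin n => (Finset.univ : Finset (Fin c → Bool)))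
    (fun i z => ∏ j, w i j (z j))
  simpa using this.symm

lemma sum_outcomeProb (θ : Fin n → Fin c → ℝ) : ∑ y, outcomeProb θ y = 1 := by
  unfold outcomeProb
  rw [sum_outcome_prod fun i j b => if b then θ i j else 1 - θ i j]
  simp

lemma sum_outcomeProb_mul_entry (θ : Fin n → Fin c → ℝ) (i : Fin n) (j : Fin c) :
    ∑ y, outcomeProb θ y * ((y i j).toNat : ℝ) = θ i j := by
  have h : ∀ y : Outcome n c, outcomeProb θ y * ((y i j).toNat : ℝ) =
      ∏ i', ∏ j', (if y i' j' then θ i' j' else 1 - θ i' j') *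
        (if i' = i ∧ j' = j then ((y i' j').toNat : ℝ) else 1) := by
    intro y
    simp only [Finset.prod_mul_distrib, outcomeProb]
    congr 1
    rw [Finset.prod_eq_single i, Finset.prod_eq_single j] <;> simp +contextual
  simp only [h]
  rw [sum_outcome_prod fun i' j' b => (if b then θ i' j' else 1 - θ i' j') *
        (if i' = i ∧ j' = j then (b.toNat : ℝ) else 1), Finset.prod_eq_single i,
        Finset.prod_eq_single j] <;> simp +contextual

lemma sum_outcomeProb_mul_reward (θ : Fin n → Fin c → ℝ) (M : Config n c) :
    ∑ y, outcomeProb θ y * (reward M y : ℝ) = mean M θ := by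
  unfold reward mean
  push_cast
  simp only [Finset.mul_sum]
  rw [Finset.sum_comm]
  refine Finset.sum_congr rfl fun i _ => ?_
  rw [Finset.sum_comm]
  refine Finset.sum_congr rfl fun j _ => ?_
  rw [← sum_outcomeProb_mul_entry θ i j, Finset.mul_sum]
  exact Finset.sum_congr rfl fun _ _ => by ring

/-! ### The law of the total reward -/

lemma activePairs_eq_filter {M : Config n c} (hM : Feasible G M) :
    activePairs M = Finset.univ.filter fun p : Fin n × Fin c => M p.1 p.2 = true := by
  ext p
  simp only [activePairs, Finset.mem_filter, Finset.mem_univ, true_and]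
  constructor
  · rintro ⟨-, h⟩
    cases hb : M p.1 p.2 <;> simp_all
  · intro h
    have h1 := Finset.single_le_sum (f := fun l => (M p.1 l).toNat) (fun _ _ => Nat.zero_le _)
      (Finset.mem_univ p.2)
    have h2 := hM.1 p.1
    simp only [h, Bool.toNat_true] at h1
    exact ⟨le_antisymm h2 h1, by simp [h]⟩

lemma reward_le {M : Config n c} (hM : Feasible G M) (y : Outcome n c) : reward M y ≤ n := by
  calc reward M y ≤ ∑ i : Fin n, 1 := Finset.sum_le_sum fun i _ =>
        (Finset.sum_le_sum fun j _ => by cases M i j <;> cases y i j <;> simp).trans (hM.1 i)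
    _ = n := by simp

-- Both sides are the coefficient of X^k in the generating function of the total reward, which
-- independence factors as the product of θX + (1 - θ) over the active pairs.
open Polynomial in
lemma aggProb_eq_sum_outcomeProb {M : Config n c} (hM : Feasible G M) (θ : Fin n → Fin c → ℝ)
    (k : ℕ) :
    aggProb k M θ = ∑ y ∈ Finset.univ.filter (fun y => reward M y = k), outcomeProb θ y := by
  have h1 : ∑ y : Outcome n c, C (outcomeProb θ y) * X ^ reward M y =
      ∏ p ∈ activePairs M, (C (θ p.1 p.2) * X + C (1 - θ p.1 p.2)) := by
    have : ∀ y : Outcome n c, C (outcomeProb θ y) * X ^ reward M y =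
        ∏ i, ∏ j, (C (if y i j then θ i j else 1 - θ i j) *
          X ^ ((M i j).toNat * (y i j).toNat)) := by
      intro y
      simp only [Finset.prod_mul_distrib, outcomeProb, reward, map_prod, Finset.prod_pow_eq_pow_sum]
    simp only [this]
    rw [sum_outcome_prod fun i j b => C (if b then θ i j else 1 - θ i j) *
          X ^ ((M i j).toNat * b.toNat), activePairs_eq_filter hM, Finset.prod_filter,
          Fintype.prod_prod_type]
    refine Finset.prod_congr rfl fun i _ => Finset.prod_congr rfl fun j _ => ?_
    cases M i j
    · simp
    · simp
  have h2 := congrArg (fun P => P.coeff k) h1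
  simp only [Finset.prod_add, Finset.prod_mul_distrib, Finset.prod_const, finsetSum_coeff,
    ← map_prod, mul_right_comm _ (X ^ _) (C _), ← C_mul, coeff_C_mul_X_pow] at h2
  rw [Finset.sum_filter, aggProb, Finset.powersetCard_eq_filter, Finset.sum_filter]
  simp only [eq_comm (a := k)] at h2
  exact h2.symm

lemma sum_outcomeProb_mul_comp_reward {M : Config n c} (hM : Feasible G M)
    (θ : Fin n → Fin c → ℝ) (g : ℕ → ℝ) :
    ∑ y, outcomeProb θ y * g (reward M y) = ∑ k ∈ Finset.range (n + 1), aggProb k M θ * g k := by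
  rw [← Finset.sum_fiberwise_of_maps_to (s := Finset.univ) (t := Finset.range (n + 1))
    (g := fun y => reward M y) fun y _ => Finset.mem_range_succ_iff.2 (reward_le hM y)]
  refine Finset.sum_congr rfl fun k _ => ?_
  rw [aggProb_eq_sum_outcomeProb hM, Finset.sum_mul]
  refine Finset.sum_congr rfl fun y hy => ?_
  rw [(Finset.mem_filter.1 hy).2]

lemma aggProb_nonneg {θ : Fin n → Fin c → ℝ} (hθ : θ ∈ paramSet n c) (k : ℕ) (M : Config n c) :
    0 ≤ aggProb k M θ :=
  Finset.sum_nonneg fun _ _ => mul_nonneg (Finset.prod_nonneg fun p _ => (hθ p.1 p.2).1)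
    (Finset.prod_nonneg fun p _ => sub_nonneg.2 (hθ p.1 p.2).2)

/-! ### Expected additive functionals -/

lemma selectionCount_extend {T : ℕ} (M : FeasibleConfig G c) (ω : Trajectory G c T)
    (z : FeasibleConfig G c × Outcome n c) :
    selectionCount M (extend ω z) = selectionCount M ω + if z.1 = M then 1 else 0 := by
  simp only [selectionCount, Finset.card_filter, Fin.sum_univ_castSucc, extend_castSucc,
    extend_last]

lemma expect_extend_add (π : Policy G c) (θ : Fin n → Fin c → ℝ) {T : ℕ}
    (F : Trajectory G c (T + 1) → ℝ) (F' : Trajectory G c T → ℝ)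
    (h : FeasibleConfig G c → Outcome n c → ℝ)
    (hF : ∀ ω M y, F (extend ω (M, y)) = F' ω + h M y) :
    expect π θ F = expect π θ F' + ∑ M, expect π θ
      (fun ω : Trajectory G c T => (π T (history ω) M).toReal) * ∑ y, outcomeProb θ y * h M y := by
  rw [expect_succ]
  simp only [hF, mul_add, Finset.sum_add_distrib, ← Finset.sum_mul, sum_outcomeProb, one_mul,
    sum_policy_eq_one, expect_add, expect_sum, expect_mul_const]

/-- Wald's identity: the current outcome is independent of the past and of the current choice, so
each play of M contributes the mean of `h M`. Both sides satisfy the same recursion in T. -/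
lemma expect_sum_slots (π : Policy G c) (θ : Fin n → Fin c → ℝ) (T : ℕ)
    (h : FeasibleConfig G c → Outcome n c → ℝ) :
    expect π θ (fun ω : Trajectory G c T => ∑ t, h (ω t).1 (ω t).2) =
      ∑ M, expect π θ (fun ω : Trajectory G c T => (selectionCount M ω : ℝ)) *
        ∑ y, outcomeProb θ y * h M y := by
  induction T with
  | zero => simp [expect, selectionCount]
  | succ T ih =>
    rw [expect_extend_add π θ _ (fun ω : Trajectory G c T => ∑ t, h (ω t).1 (ω t).2) h
      (by intro ω M y; simp [Fin.sum_univ_castSucc]), ih, ← Finset.sum_add_distrib]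
    refine Finset.sum_congr rfl fun M _ => ?_
    rw [expect_extend_add π θ (fun ω : Trajectory G c (T + 1) => (selectionCount M ω : ℝ))
      (fun ω : Trajectory G c T => (selectionCount M ω : ℝ))
      (fun M' _ => if M' = M then 1 else 0) (by intro ω M y; simp [selectionCount_extend])]
    simp [sum_outcomeProb, add_mul]

lemma expect_one (π : Policy G c) (θ : Fin n → Fin c → ℝ) (T : ℕ) :
    expect π θ (fun _ : Trajectory G c T => (1 : ℝ)) = 1 := by
  induction T with
  | zero => simp [expect, trajProb]
  | succ T ih =>
    rw [expect_succ]
    simpa [sum_outcomeProb, sum_policy_eq_one] using ih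

lemma sum_selectionCount {T : ℕ} (ω : Trajectory G c T) : ∑ M, selectionCount M ω = T := by
  have := Finset.card_eq_sum_card_fiberwise (f := fun t : Fin T => (ω t).1)
    (s := Finset.univ) (t := Finset.univ) (by simp)
  simpa [selectionCount] using this.symm

lemma sum_expect_selectionCount (π : Policy G c) (θ : Fin n → Fin c → ℝ) (T : ℕ) :
    ∑ M, expect π θ (fun ω : Trajectory G c T => (selectionCount M ω : ℝ)) = T := by
  rw [← expect_sum]
  simp only [← Nat.cast_sum, sum_selectionCount]
  simpa [expect_one] using expect_const_mul π θ (T := T) (T : ℝ) fun _ => 1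

lemma regret_eq (π : Policy G c) (θ : Fin n → Fin c → ℝ) (T : ℕ) :
    regret π θ T = ∑ M, expect π θ (fun ω : Trajectory G c T => (selectionCount M ω : ℝ)) *
      (optMean G θ - mean M.1 θ) := by
  have h1 : ∀ M : FeasibleConfig G c,
      expect π θ (fun ω : Trajectory G c T => ∑ t, (reward M.1 (ω t).2 : ℝ)) =
        T * mean M.1 θ := by
    intro M
    rw [expect_sum_slots π θ T fun _ y => (reward M.1 y : ℝ), ← Finset.sum_mul,
      sum_expect_selectionCount, sum_outcomeProb_mul_reward]
  unfold regret
  rw [expect_sum_slots π θ T fun M y => (reward M.1 y : ℝ)]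
  simp only [h1, sum_outcomeProb_mul_reward, mul_sub, Finset.sum_sub_distrib, ← Finset.sum_mul,
    sum_expect_selectionCount]
  rw [optMean, Real.mul_iSup_of_nonneg (Nat.cast_nonneg T)]

end

/-! ### Change of measure -/

section

variable {n c : ℕ} {G : SimpleGraph (Fin n)}

/-- The log-likelihood ratio of one observation. -/
noncomputable def logRatio (θ lam : Fin n → Fin c → ℝ) (h : FeasibleConfig G c × ℕ) : ℝ :=
  Real.log (aggProb h.2 h.1.1 θ / aggProb h.2 h.1.1 lam)

/-- The real-valued divergence of the laws of the total reward; it equals `aggKL` when the latter is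
finite. -/
noncomputable def realKL (M : Config n c) (θ lam : Fin n → Fin c → ℝ) : ℝ :=
  ∑ k ∈ Finset.range (n + 1),
    aggProb k M θ * Real.log (aggProb k M θ / aggProb k M lam)

/-- The policy factors are common to both laws, so the likelihood ratio involves the rewards alone.
It is only an inequality because lam may charge observations that are null under θ. -/
lemma expect_likelihood_le (π : Policy G c) {θ lam : Fin n → Fin c → ℝ} (hθ : θ ∈ paramSet n c)
    (hlam : lam ∈ paramSet n c)
    (hac : ∀ (M : FeasibleConfig G c) k, aggProb k M.1 θ ≠ 0 → aggProb k M.1 lam ≠ 0) (T : ℕ)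
    (g : (Fin T → FeasibleConfig G c × ℕ) → ℝ) (hg : ∀ h, 0 ≤ g h) :
    expect π θ (fun ω : Trajectory G c T =>
        g (history ω) * Real.exp (-∑ t, logRatio θ lam (history ω t))) ≤
      expect π lam (fun ω : Trajectory G c T => g (history ω)) := by
  induction T with
  | zero => simp [expect, trajProb]
  | succ T ih =>
    rw [expect_succ π θ, expect_succ π lam]
    -- The conditional expectation of g under lam given the first T observations, to which the
    -- induction hypothesis applies.
    let g' : (Fin T → FeasibleConfig G c × ℕ) → ℝ := fun h =>
      ∑ M, (π T h M).toReal * ∑ k ∈ Finset.range (n + 1), aggProb k M.1 lam *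
        g (Fin.snoc (α := fun _ => FeasibleConfig G c × ℕ) h (M, k))
    have hg' : ∀ h, 0 ≤ g' h := fun h => Finset.sum_nonneg fun M _ =>
      mul_nonneg ENNReal.toReal_nonneg <| Finset.sum_nonneg fun k _ =>
        mul_nonneg (aggProb_nonneg hlam _ _) (hg _)
    refine le_trans (expect_mono π hθ fun ω => ?_) ((ih g' hg').trans
      (expect_mono π hlam fun ω => le_of_eq ?_))
    · rw [Finset.sum_mul]
      refine Finset.sum_le_sum fun M _ => ?_
      rw [mul_assoc]
      refine mul_le_mul_of_nonneg_left ?_ ENNReal.toReal_nonneg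
      simp only [history_extend, Fin.sum_univ_castSucc, Fin.snoc_castSucc, Fin.snoc_last]
      rw [sum_outcomeProb_mul_comp_reward M.2 θ fun k =>
        g (Fin.snoc (α := fun _ => FeasibleConfig G c × ℕ) (history ω) (M, k)) *
          Real.exp (-(∑ t, logRatio θ lam (history ω t) + logRatio θ lam (M, k))),
        Finset.sum_mul]
      refine Finset.sum_le_sum fun k _ => ?_
      have key : aggProb k M.1 θ * Real.exp (-logRatio θ lam (M, k)) ≤ aggProb k M.1 lam := by
        by_cases h0 : aggProb k M.1 θ = 0
        · rw [h0, zero_mul]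
          exact aggProb_nonneg hlam _ _
        · have h1 := (aggProb_nonneg hθ k M.1).lt_of_ne' h0
          have h2 := (aggProb_nonneg hlam k M.1).lt_of_ne' (hac M k h0)
          rw [logRatio, Real.exp_neg, Real.exp_log (div_pos h1 h2)]
          field_simp
          exact le_rfl
      rw [neg_add, Real.exp_add]
      calc _ = (aggProb k M.1 θ * Real.exp (-logRatio θ lam (M, k))) *
            (g (Fin.snoc (α := fun _ => FeasibleConfig G c × ℕ) (history ω) (M, k)) *
              Real.exp (-∑ t, logRatio θ lam (history ω t))) := by ring
        _ ≤ aggProb k M.1 lam *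
            (g (Fin.snoc (α := fun _ => FeasibleConfig G c × ℕ) (history ω) (M, k)) *
              Real.exp (-∑ t, logRatio θ lam (history ω t))) :=
          mul_le_mul_of_nonneg_right key (mul_nonneg (hg _) (Real.exp_pos _).le)
        _ = _ := by ring
    · refine Finset.sum_congr rfl fun M _ => ?_
      simp only [history_extend]
      rw [sum_outcomeProb_mul_comp_reward M.2 lam fun k =>
        g (Fin.snoc (α := fun _ => FeasibleConfig G c × ℕ) (history ω) (M, k))]

/-- A transport inequality: the information collected in `T` slots dominates the
Donsker-Varadhan-type functional of every function of the observations. -/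
lemma expect_sub_expect_exp_le (π : Policy G c) {θ lam : Fin n → Fin c → ℝ}
    (hθ : θ ∈ paramSet n c) (hlam : lam ∈ paramSet n c)
    (hac : ∀ (M : FeasibleConfig G c) k, aggProb k M.1 θ ≠ 0 → aggProb k M.1 lam ≠ 0) (T : ℕ)
    (f : (Fin T → FeasibleConfig G c × ℕ) → ℝ) :
    expect π θ (fun ω : Trajectory G c T => f (history ω)) -
        (expect π lam (fun ω : Trajectory G c T => Real.exp (f (history ω))) - 1) ≤
      ∑ Q, expect π θ (fun ω : Trajectory G c T => (selectionCount Q ω : ℝ)) *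
        realKL Q.1 θ lam := by
  have h1 : expect π θ (fun ω : Trajectory G c T => ∑ t, logRatio θ lam (history ω t)) =
      ∑ Q, expect π θ (fun ω : Trajectory G c T => (selectionCount Q ω : ℝ)) *
        realKL Q.1 θ lam := by
    have := expect_sum_slots π θ T fun M y => logRatio θ lam (M, reward M.1 y)
    refine this.trans (Finset.sum_congr rfl fun Q _ => ?_)
    rw [sum_outcomeProb_mul_comp_reward Q.2 θ fun k => logRatio θ lam (Q, k)]
    rfl
  have h2 := expect_likelihood_le π hθ hlam hac T (fun h => Real.exp (f h))
    fun _ => (Real.exp_pos _).le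
  have h3 : expect π θ (fun ω : Trajectory G c T =>
      (f (history ω) - ∑ t, logRatio θ lam (history ω t)) + 1) ≤
      expect π θ (fun ω : Trajectory G c T => Real.exp (f (history ω)) *
        Real.exp (-∑ t, logRatio θ lam (history ω t))) :=
    -- The inequality u + 1 ≤ exp u, with u equal to f minus the log-likelihood ratio.
    expect_mono π hθ fun ω => by
      rw [← Real.exp_add, ← sub_eq_add_neg]
      exact Real.add_one_le_exp _
  rw [expect_add, expect_sub, expect_one, h1] at h3
  linarith

lemma exp_mul_le_one_add {a z : ℝ} (hz : 0 ≤ z) (hz1 : z ≤ 1) :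
    Real.exp (a * z) ≤ 1 + z * Real.exp a := by
  have h := convexOn_exp.2 (Set.mem_univ (0 : ℝ)) (Set.mem_univ a) (sub_nonneg.2 hz1) hz
    (by ring)
  simp only [smul_eq_mul, mul_zero, zero_add, Real.exp_zero, mul_one] at h
  rw [mul_comm a z]
  linarith

lemma selectionCount_le {T : ℕ} (M : FeasibleConfig G c) (ω : Trajectory G c T) :
    selectionCount M ω ≤ T := by
  simpa [selectionCount] using Finset.card_filter_le (Finset.univ : Finset (Fin T)) _

/-- The transport inequality for f = a T_M / T. As T_M / T lies in [0,1], convexity bounds exp f by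
a function linear in the count, so only the expected count under lam enters. -/
lemma selectionCount_information_bound (π : Policy G c) {θ lam : Fin n → Fin c → ℝ}
    (hθ : θ ∈ paramSet n c) (hlam : lam ∈ paramSet n c)
    (hac : ∀ (M : FeasibleConfig G c) k, aggProb k M.1 θ ≠ 0 → aggProb k M.1 lam ≠ 0) (T : ℕ)
    (M : FeasibleConfig G c) (a : ℝ) :
    a * (expect π θ (fun ω : Trajectory G c T => (selectionCount M ω : ℝ)) / T) -
        Real.exp a * (expect π lam (fun ω : Trajectory G c T => (selectionCount M ω : ℝ)) / T) ≤
      ∑ Q, expect π θ (fun ω : Trajectory G c T => (selectionCount Q ω : ℝ)) *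
        realKL Q.1 θ lam := by
  have h := expect_sub_expect_exp_le π hθ hlam hac T fun h =>
    a * (((Finset.univ.filter fun t => (h t).1 = M).card : ℝ) / T)
  have h1 : ∀ ω : Trajectory G c T,
      (Finset.univ.filter fun t => (history ω t).1 = M).card = selectionCount M ω := fun _ => rfl
  simp only [h1] at h
  have h2 : expect π lam (fun ω : Trajectory G c T =>
      Real.exp (a * ((selectionCount M ω : ℝ) / T))) ≤
      expect π lam (fun ω : Trajectory G c T =>
        1 + (selectionCount M ω : ℝ) * ((T : ℝ)⁻¹ * Real.exp a)) :=
    expect_mono π hlam fun ω => by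
      refine (exp_mul_le_one_add (by positivity) (div_le_one_of_le₀ ?_ (by positivity))).trans
        (le_of_eq (by ring))
      exact_mod_cast selectionCount_le M ω
  rw [expect_add, expect_one, expect_mul_const] at h2
  have h3 : expect π θ (fun ω : Trajectory G c T => a * ((selectionCount M ω : ℝ) / T)) =
      a * (expect π θ (fun ω : Trajectory G c T => (selectionCount M ω : ℝ)) / T) := by
    simp only [div_eq_mul_inv, expect_const_mul, expect_mul_const]
  rw [h3] at h
  rw [div_eq_mul_inv (expect π lam _)]
  linarith

end

/-! ### The divergence as a function of the alternative parameter -/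

section

variable {n c : ℕ} {G : SimpleGraph (Fin n)}

lemma EReal.coe_sum_real {ι : Type*} (s : Finset ι) (f : ι → ℝ) :
    ((∑ i ∈ s, f i : ℝ) : EReal) = ∑ i ∈ s, (f i : EReal) := by
  classical
  induction s using Finset.induction_on with
  | empty => simp
  | insert i s hi ih => rw [Finset.sum_insert hi, Finset.sum_insert hi, EReal.coe_add, ih]

lemma aggKL_eq_realKL {M : Config n c} {θ lam : Fin n → Fin c → ℝ}
    (h : ∀ k ∈ Finset.range (n + 1), aggProb k M θ ≠ 0 → aggProb k M lam ≠ 0) :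
    aggKL M θ lam = (realKL M θ lam : EReal) := by
  rw [realKL, EReal.coe_sum_real, aggKL]
  refine Finset.sum_congr rfl fun k hk => ?_
  by_cases h0 : aggProb k M θ = 0
  · simp [h0]
  · rw [if_neg h0, if_neg (h k hk h0)]

lemma EReal.sum_ne_bot {ι : Type*} (s : Finset ι) {f : ι → EReal} (h : ∀ i ∈ s, f i ≠ ⊥) :
    ∑ i ∈ s, f i ≠ ⊥ :=
  Finset.sum_induction f (· ≠ ⊥) (fun _ _ ha hb => EReal.add_ne_bot_iff.2 ⟨ha, hb⟩)
    EReal.zero_ne_bot h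

lemma EReal.sum_eq_top {ι : Type*} {s : Finset ι} {f : ι → EReal} (h : ∀ i ∈ s, f i ≠ ⊥)
    {i : ι} (hi : i ∈ s) (hf : f i = ⊤) : ∑ i ∈ s, f i = ⊤ := by
  classical
  rw [← Finset.add_sum_erase s f hi, hf]
  exact EReal.top_add_of_ne_bot (EReal.sum_ne_bot _ fun j hj => h j (Finset.mem_of_mem_erase hj))

lemma aggKL_eq_top {M : Config n c} {θ lam : Fin n → Fin c → ℝ} {k : ℕ}
    (hk : k ∈ Finset.range (n + 1)) (h : aggProb k M θ ≠ 0) (h' : aggProb k M lam = 0) :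
    aggKL M θ lam = ⊤ := by
  refine EReal.sum_eq_top (fun j _ => ?_) hk (by rw [if_neg h, if_pos h'])
  split_ifs
  · exact EReal.zero_ne_bot
  · exact top_ne_bot
  · exact EReal.coe_ne_bot _

lemma continuous_aggProb (k : ℕ) (M : Config n c) : Continuous (aggProb k M) := by
  unfold aggProb
  fun_prop

/-- Only the values k charged by θ matter, and there the limiting denominator is nonzero. -/
lemma tendsto_realKL {ι : Type*} {l : Filter ι} {M : Config n c} {θ lam : Fin n → Fin c → ℝ}
    (h : ∀ k ∈ Finset.range (n + 1), aggProb k M θ ≠ 0 → aggProb k M lam ≠ 0)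
    {u : ι → Fin n → Fin c → ℝ} (hu : Tendsto u l (𝓝 lam)) :
    Tendsto (fun e => realKL M θ (u e)) l (𝓝 (realKL M θ lam)) := by
  refine tendsto_finsetSum _ fun k hk => ?_
  by_cases h0 : aggProb k M θ = 0
  · simp only [h0, zero_mul, tendsto_const_nhds]
  · have h1 : Tendsto (fun e => aggProb k M (u e)) l (𝓝 (aggProb k M lam)) :=
      ((continuous_aggProb k M).tendsto lam).comp hu
    exact ((Tendsto.div tendsto_const_nhds h1 (h k hk h0)).log (div_ne_zero h0 (h k hk h0))).const_mul _

/-- The law of the total reward under `θ` is absolutely continuous with respect to that under `lam`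
as soon as each entry of `lam` is either interior or equal to that of `θ`. -/
lemma aggProb_ne_zero_of_interior {θ lam : Fin n → Fin c → ℝ} (hlam : lam ∈ paramSet n c)
    (h : ∀ i j, lam i j = θ i j ∨ (0 < lam i j ∧ lam i j < 1)) (M : Config n c) (k : ℕ)
    (hk : aggProb k M θ ≠ 0) : aggProb k M lam ≠ 0 := by
  obtain ⟨A, hA, hne⟩ := Finset.exists_ne_zero_of_sum_ne_zero hk
  have hnn : ∀ B ∈ (activePairs M).powersetCard k,
      0 ≤ (∏ p ∈ B, lam p.1 p.2) * ∏ p ∈ activePairs M \ B, (1 - lam p.1 p.2) := fun _ _ =>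
    mul_nonneg (Finset.prod_nonneg fun p _ => (hlam p.1 p.2).1)
      (Finset.prod_nonneg fun p _ => sub_nonneg.2 (hlam p.1 p.2).2)
  intro h0
  have h1 := (Finset.sum_eq_zero_iff_of_nonneg hnn).1 h0 A hA
  obtain ⟨hθ1, hθ2⟩ := mul_ne_zero_iff.1 hne
  refine mul_ne_zero (Finset.prod_ne_zero_iff.2 fun p hp => ?_)
    (Finset.prod_ne_zero_iff.2 fun p hp => ?_) h1
  · rcases h p.1 p.2 with h | h
    · rw [h]; exact Finset.prod_ne_zero_iff.1 hθ1 p hp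
    · exact h.1.ne'
  · rcases h p.1 p.2 with h | h
    · rw [h]; exact Finset.prod_ne_zero_iff.1 hθ2 p hp
    · exact (sub_pos.2 h.2).ne'

lemma realKL_eq_zero_of_eq_on {M : Config n c} (hM : Feasible G M) {θ lam : Fin n → Fin c → ℝ}
    (h : ∀ i j, M i j = true → lam i j = θ i j) : realKL M θ lam = 0 := by
  have h1 : ∀ k, aggProb k M lam = aggProb k M θ := by
    intro k
    have hp : ∀ p ∈ activePairs M, lam p.1 p.2 = θ p.1 p.2 := fun p hp => by
      rw [activePairs_eq_filter hM] at hp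
      exact h _ _ (Finset.mem_filter.1 hp).2
    refine Finset.sum_congr rfl fun A hA => ?_
    have hA' := (Finset.mem_powersetCard.1 hA).1
    congr 1
    · exact Finset.prod_congr rfl fun p hpA => hp p (hA' hpA)
    · exact Finset.prod_congr rfl fun p hpA => by rw [hp p (Finset.mem_sdiff.1 hpA).1]
  refine Finset.sum_eq_zero fun k _ => ?_
  rw [h1]
  by_cases h0 : aggProb k M θ = 0
  · simp [h0]
  · simp [div_self h0]

/-! ### Generic perturbations have a unique optimal configuration -/

lemma feasible_iff {M : Config n c} : Feasible G M ↔
    (∀ i j j', M i j = true → M i j' = true → j = j') ∧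
      ∀ i i', G.Adj i i' → ∀ j, ¬ (M i j = true ∧ M i' j = true) := by
  refine and_congr (forall_congr' fun i => ?_) (forall_congr' fun i => forall_congr' fun i' =>
    forall_congr' fun _ => forall_congr' fun j => ?_)
  · have : ∑ j, (M i j).toNat = (Finset.univ.filter fun j => M i j = true).card := by
      rw [Finset.card_filter]
      exact Finset.sum_congr rfl fun j _ => by cases M i j <;> rfl
    rw [this, Finset.card_le_one]
    simp only [Finset.mem_filter, Finset.mem_univ, true_and]
    exact ⟨fun h j j' hj hj' => h j hj j' hj', fun h j hj j' hj' => h j j' hj hj'⟩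
  · cases M i j <;> cases M i' j <;> simp

/-- Feasibility forbids only certain couples of active pairs, so it can be tested two active pairs
at a time. -/
lemma feasible_of_pairs {U : Config n c} (h : ∀ i j i' j', U i j = true → U i' j' = true →
    ∃ M : FeasibleConfig G c, M.1 i j = true ∧ M.1 i' j' = true) : Feasible G U := by
  refine feasible_iff.2 ⟨fun i j j' hj hj' => ?_, fun i i' hadj j hj => ?_⟩
  · obtain ⟨M, h1, h2⟩ := h i j i j' hj hj'
    exact (feasible_iff.1 M.2).1 i j j' h1 h2
  · obtain ⟨M, h1, h2⟩ := h i j i' j hj.1 hj.2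
    exact (feasible_iff.1 M.2).2 i i' hadj j ⟨h1, h2⟩

lemma mean_lt_mean {M U : Config n c} {lam : Fin n → Fin c → ℝ} (hlam : ∀ i j, 0 < lam i j)
    (h : ∀ i j, M i j = true → U i j = true) (hne : M ≠ U) : mean M lam < mean U lam := by
  have hle : ∀ i j, ((M i j).toNat : ℝ) * lam i j ≤ ((U i j).toNat : ℝ) * lam i j := fun i j => by
    refine mul_le_mul_of_nonneg_right ?_ (hlam i j).le
    have := h i j
    revert this
    cases M i j <;> cases U i j <;> simp
  obtain ⟨i, hi⟩ := Function.ne_iff.1 hne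
  obtain ⟨j, hj⟩ := Function.ne_iff.1 hi
  refine Finset.sum_lt_sum (fun i _ => Finset.sum_le_sum fun j _ => hle i j)
    ⟨i, Finset.mem_univ _, Finset.sum_lt_sum (fun j _ => hle i j) ⟨j, Finset.mem_univ _, ?_⟩⟩
  have h1 := h i j
  have h2 := hlam i j
  revert hj h1
  cases M i j <;> cases U i j <;> simp [h2]

/-- If all entries are positive, and configurations that differ off `N` never tie, then the optimal
configuration is unique. -/
lemma exists_isUniqueOptimal {lam : Fin n → Fin c → ℝ} (hlam : ∀ i j, 0 < lam i j)
    (N : FeasibleConfig G c)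
    (htie : ∀ M₁ M₂ : FeasibleConfig G c,
      (∃ i j, N.1 i j = false ∧ M₁.1 i j ≠ M₂.1 i j) → mean M₁.1 lam ≠ mean M₂.1 lam) :
    ∃ M : FeasibleConfig G c, IsUniqueOptimal lam M := by
  have : Nonempty (FeasibleConfig G c) := ⟨N⟩
  obtain ⟨M₁, hmax⟩ := Finite.exists_max fun M : FeasibleConfig G c => mean M.1 lam
  refine ⟨M₁, fun M₂ hne => (hmax M₂).lt_of_ne fun heq => hne ?_⟩
  have hagree : ∀ i j, N.1 i j = false → M₁.1 i j = M₂.1 i j := by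
    by_contra! hc
    exact htie M₁ M₂ hc heq.symm
  -- Two optima that agree off N have a feasible union: any two of its pairs lie together in M₁, M₂
  -- or N. With positive entries, the union would be strictly better than an optimum properly
  -- contained in it.
  let U : Config n c := fun i j => M₁.1 i j || M₂.1 i j
  have hU : Feasible G U := by
    refine feasible_of_pairs fun i j i' j' h1 h2 => ?_
    simp only [U, Bool.or_eq_true] at h1 h2
    have a1 := hagree i j
    have a2 := hagree i' j'
    cases hN1 : N.1 i j
    · rw [a1 hN1, or_self] at h1
      rcases h2 with h2 | h2
      · exact ⟨M₁, (a1 hN1).trans h1, h2⟩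
      · exact ⟨M₂, h1, h2⟩
    · cases hN2 : N.1 i' j'
      · rw [a2 hN2, or_self] at h2
        rcases h1 with h1 | h1
        · exact ⟨M₁, h1, (a2 hN2).trans h2⟩
        · exact ⟨M₂, h1, h2⟩
      · exact ⟨N, hN1, hN2⟩
  have e1 : M₁.1 = U := by
    by_contra hc
    exact (hmax ⟨U, hU⟩).not_gt (mean_lt_mean hlam (fun i j h => by simp [U, h]) hc)
  have e2 : M₂.1 = U := by
    by_contra hc
    exact (hmax ⟨U, hU⟩).not_gt (heq ▸ mean_lt_mean hlam (fun i j h => by simp [U, h]) hc)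
  exact Subtype.ext (e2.trans e1.symm)

/-- Dropping a pair of mean zero would give another optimum. -/
lemma IsUniqueOptimal.pos {θ : Fin n → Fin c → ℝ} (hθ : θ ∈ paramSet n c)
    {N : FeasibleConfig G c} (hN : IsUniqueOptimal θ N) {i : Fin n} {j : Fin c}
    (h : N.1 i j = true) : 0 < θ i j := by
  refine (hθ i j).1.lt_of_ne' fun h0 => ?_
  let U : Config n c := fun i' j' => if i' = i ∧ j' = j then false else N.1 i' j'
  have hsub : ∀ i' j', U i' j' = true → N.1 i' j' = true := fun i' j' => by
    simp only [U]; split_ifs <;> simp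
  have hU : Feasible G U := feasible_of_pairs fun i j i' j' h1 h2 => ⟨N, hsub _ _ h1, hsub _ _ h2⟩
  have hne : (⟨U, hU⟩ : FeasibleConfig G c) ≠ N := fun he => by
    have := congrFun (congrFun (congrArg Subtype.val he) i) j
    simp [U, h] at this
  refine (hN _ hne).ne (Finset.sum_congr rfl fun i' _ => Finset.sum_congr rfl fun j' _ => ?_)
  simp only [U]
  split_ifs with hij
  · rw [hij.1, hij.2, h0, mul_zero, mul_zero]
  · rfl

/-- A generic move of `lam` into the open cube that fixes the entries used by `N`. -/
noncomputable def perturb (N : Config n c) (lam : Fin n → Fin c → ℝ) (e : ℝ) :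
    Fin n → Fin c → ℝ :=
  fun i j => if N i j then lam i j else
    -- The first two terms lie in [e/2, 1 - e/2], and the last is at most e/4. The exponents are
    -- distinct and exceed 1, so each entry has its own monomial, untouched by the affine part.
    (1 - e) * lam i j + e / 2 + e ^ (2 + (finProdFinEquiv (i, j) : ℕ)) / 4

lemma perturb_of_mem {N : Config n c} (lam : Fin n → Fin c → ℝ) (e : ℝ) {i : Fin n} {j : Fin c}
    (h : N i j = true) : perturb N lam e i j = lam i j := by simp [perturb, h]

lemma perturb_interior {N : Config n c} {lam : Fin n → Fin c → ℝ} (hlam : lam ∈ paramSet n c)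
    {e : ℝ} (he : 0 < e) (he1 : e < 1) {i : Fin n} {j : Fin c} (h : N i j = false) :
    0 < perturb N lam e i j ∧ perturb N lam e i j < 1 := by
  obtain ⟨h0, h1⟩ := hlam i j
  have hp : 0 < e ^ (2 + (finProdFinEquiv (i, j) : ℕ)) := pow_pos he _
  have hp' : e ^ (2 + (finProdFinEquiv (i, j) : ℕ)) ≤ e ^ 1 :=
    pow_le_pow_of_le_one he.le he1.le (by omega)
  have ha : 0 ≤ (1 - e) * lam i j := mul_nonneg (by linarith) h0
  have hb : (1 - e) * lam i j ≤ (1 - e) * 1 := mul_le_mul_of_nonneg_left h1 (by linarith)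
  simp only [perturb, h, Bool.false_eq_true, if_false]
  constructor <;> linarith

lemma continuous_perturb (N : Config n c) (lam : Fin n → Fin c → ℝ) :
    Continuous (perturb N lam) := by
  refine continuous_pi fun i => continuous_pi fun j => ?_
  unfold perturb
  split_ifs <;> fun_prop

lemma tendsto_perturb (N : Config n c) (lam : Fin n → Fin c → ℝ) :
    Tendsto (perturb N lam) (𝓝[>] 0) (𝓝 lam) := by
  have h0 : perturb N lam 0 = lam := by
    funext i j
    simp [perturb]
  have := (continuous_perturb N lam).tendsto 0
  rw [h0] at this
  exact this.mono_left nhdsWithin_le_nhds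

lemma continuous_mean (M : Config n c) : Continuous (mean M) := by
  unfold mean
  fun_prop

-- The difference of the means is a polynomial in e. At an entry off N where M₁ and M₂ differ, its
-- private monomial has coefficient ±1/4, so the polynomial is nonzero and has finitely many roots.
open Polynomial in
lemma eventually_mean_perturb_ne (N : Config n c) (lam : Fin n → Fin c → ℝ) {M₁ M₂ : Config n c}
    (h : ∃ i j, N i j = false ∧ M₁ i j ≠ M₂ i j) :
    ∀ᶠ e in 𝓝[>] (0 : ℝ), mean M₁ (perturb N lam e) ≠ mean M₂ (perturb N lam e) := by
  obtain ⟨i, j, hN, hne⟩ := h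
  let R : Fin n → Fin c → ℝ[X] := fun i j => if N i j then C (lam i j) else
    C (lam i j) + C (1 / 2 - lam i j) * X ^ 1 +
      C (1 / 4) * X ^ (2 + (finProdFinEquiv (i, j) : ℕ))
  let P : Config n c → ℝ[X] := fun M => ∑ i, ∑ j, C ((M i j).toNat : ℝ) * R i j
  have heval : ∀ M e, (P M).eval e = mean M (perturb N lam e) := by
    intro M e
    simp only [P, mean, eval_finsetSum, eval_mul, eval_C]
    refine Finset.sum_congr rfl fun i _ => Finset.sum_congr rfl fun j _ => ?_
    simp only [R, perturb]
    split_ifs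
    · simp
    · simp only [eval_add, eval_mul, eval_C, eval_pow, eval_X]
      ring
  have hcoeff : ∀ M, (P M).coeff (2 + (finProdFinEquiv (i, j) : ℕ)) =
      ((M i j).toNat : ℝ) * (1 / 4) := by
    intro M
    have hR : ∀ i' j', (R i' j').coeff (2 + (finProdFinEquiv (i, j) : ℕ)) =
        if i' = i ∧ j' = j then 1 / 4 else 0 := by
      intro i' j'
      have h1 : (2 + (finProdFinEquiv (i, j) : ℕ)) ≠ 0 := by omega
      have h2 : (2 + (finProdFinEquiv (i, j) : ℕ)) ≠ 1 := by omega
      have h3 : (2 + (finProdFinEquiv (i, j) : ℕ) = 2 + (finProdFinEquiv (i', j') : ℕ)) ↔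
          i' = i ∧ j' = j := by
        rw [Nat.add_left_cancel_iff, ← Fin.ext_iff, finProdFinEquiv.injective.eq_iff,
          Prod.mk.injEq]
        exact and_congr eq_comm eq_comm
      simp only [R]
      split_ifs with hNij hij hij
      · rw [hij.1, hij.2, hN] at hNij
        exact absurd hNij (by simp)
      · rw [coeff_C, if_neg h1]
      · simp only [coeff_add, coeff_C, coeff_C_mul_X_pow, h1, h2, if_false, hij, if_true]
        simp
      · simp only [coeff_add, coeff_C, coeff_C_mul_X_pow, h1, h2, if_false, h3, hij]
        simp
    simp only [P, finsetSum_coeff, coeff_C_mul, hR]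
    rw [Finset.sum_eq_single i, Finset.sum_eq_single j] <;> simp +contextual
  have hP : P M₁ - P M₂ ≠ 0 := by
    intro h0
    have := congrArg (fun p => p.coeff (2 + (finProdFinEquiv (i, j) : ℕ))) h0
    simp only [coeff_sub, hcoeff, coeff_zero] at this
    revert hne this
    cases M₁ i j <;> cases M₂ i j <;> norm_num
  -- The point 0 is removed because it is a root whenever M₁ and M₂ tie at lam.
  have hfin : ({x | (P M₁ - P M₂).IsRoot x} \ {0}).Finite :=
    (finite_setOfPred_isRoot hP).subset Set.sdiff_subset
  have h1 : ∀ᶠ e in 𝓝[>] (0 : ℝ), e ∉ ({x | (P M₁ - P M₂).IsRoot x} \ {0}) :=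
    mem_nhdsWithin_of_mem_nhds (hfin.isClosed.compl_mem_nhds (by simp))
  filter_upwards [h1, self_mem_nhdsWithin] with e he hpos heq
  refine he ⟨?_, (Set.mem_Ioi.1 hpos).ne'⟩
  simp [heval, heq]

lemma mean_congr {M : Config n c} {θ lam : Fin n → Fin c → ℝ}
    (h : ∀ i j, M i j = true → lam i j = θ i j) : mean M lam = mean M θ := by
  refine Finset.sum_congr rfl fun i _ => Finset.sum_congr rfl fun j _ => ?_
  have := h i j
  revert this
  cases M i j <;> simp

lemma mean_le_optMean (θ : Fin n → Fin c → ℝ) (M : FeasibleConfig G c) :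
    mean M.1 θ ≤ optMean G θ :=
  le_ciSup (f := fun M : FeasibleConfig G c => mean M.1 θ) (Set.finite_range _).bddAbove M

lemma IsUniqueOptimal.optMean_eq {θ : Fin n → Fin c → ℝ} {N : FeasibleConfig G c}
    (hN : IsUniqueOptimal θ N) : optMean G θ = mean N.1 θ := by
  have : Nonempty (FeasibleConfig G c) := ⟨N⟩
  refine le_antisymm (ciSup_le fun M => ?_) (mean_le_optMean θ N)
  by_cases h : M = N
  · rw [h]
  · exact (hN M h).le

/-- Every alternative in `badSet` is a limit of alternatives with a unique optimal configuration,
with respect to which the law of the total reward under `θ` is absolutely continuous. -/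
lemma eventually_perturb_badSet {θ : Fin n → Fin c → ℝ} (hθ : θ ∈ paramSet n c)
    {N M : FeasibleConfig G c} (hN : IsUniqueOptimal θ N) {lam : Fin n → Fin c → ℝ}
    (hlam : lam ∈ badSet θ N M) :
    ∀ᶠ e in 𝓝[>] (0 : ℝ), perturb N.1 lam e ∈ paramSet n c ∧
      (∀ i j, N.1 i j = true → perturb N.1 lam e i j = θ i j) ∧
      (∀ (Q : FeasibleConfig G c) k, aggProb k Q.1 θ ≠ 0 →
        aggProb k Q.1 (perturb N.1 lam e) ≠ 0) ∧
      ∃ M', M' ≠ N ∧ IsUniqueOptimal (perturb N.1 lam e) M' := by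
  obtain ⟨hpar, hagree, hopt⟩ := hlam
  have h1 : ∀ᶠ e in 𝓝[>] (0 : ℝ), optMean G θ < mean M.1 (perturb N.1 lam e) :=
    (((continuous_mean M.1).tendsto lam).comp (tendsto_perturb N.1 lam)).eventually
      (lt_mem_nhds hopt)
  have h2 : ∀ᶠ e in 𝓝[>] (0 : ℝ), ∀ M₁ M₂ : FeasibleConfig G c,
      (∃ i j, N.1 i j = false ∧ M₁.1 i j ≠ M₂.1 i j) →
        mean M₁.1 (perturb N.1 lam e) ≠ mean M₂.1 (perturb N.1 lam e) := by
    simp only [eventually_all]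
    exact fun M₁ M₂ h => eventually_mean_perturb_ne N.1 lam h
  have h3 : ∀ᶠ e in 𝓝[>] (0 : ℝ), e < 1 :=
    mem_nhdsWithin_of_mem_nhds (gt_mem_nhds one_pos)
  filter_upwards [h1, h2, h3, self_mem_nhdsWithin] with e he1 he2 he3 he4
  have he0 : 0 < e := he4
  have hfix : ∀ i j, N.1 i j = true → perturb N.1 lam e i j = θ i j := fun i j h => by
    rw [perturb_of_mem lam e h, hagree i j h]
  have hint : ∀ i j, N.1 i j = false → 0 < perturb N.1 lam e i j ∧ perturb N.1 lam e i j < 1 :=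
    fun i j h => perturb_interior hpar he0 he3 h
  have hmem : perturb N.1 lam e ∈ paramSet n c := fun i j => by
    cases h : N.1 i j
    · exact ⟨(hint i j h).1.le, (hint i j h).2.le⟩
    · rw [hfix i j h]
      exact hθ i j
  have hpos : ∀ i j, 0 < perturb N.1 lam e i j := fun i j => by
    cases h : N.1 i j
    · exact (hint i j h).1
    · rw [hfix i j h]
      exact hN.pos hθ h
  obtain ⟨M', hM'⟩ := exists_isUniqueOptimal hpos N he2
  refine ⟨hmem, hfix, fun Q k => aggProb_ne_zero_of_interior hmem (fun i j => ?_) Q.1 k,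
    M', ?_, hM'⟩
  · cases h : N.1 i j
    · exact Or.inr (hint i j h)
    · exact Or.inl (hfix i j h)
  -- The perturbation leaves the mean of N at μ⋆, which M still exceeds, so N cannot be the new
  -- optimum.
  · rintro rfl
    have hle := mean_le_optMean (perturb M'.1 lam e) M
    rw [hM'.optMean_eq, mean_congr hfix, ← hN.optMean_eq] at hle
    exact hle.not_gt he1

/-! ### Asymptotics of the selection counts -/

/-- Expected number of selections of `M` among the first `T` slots. -/
noncomputable def expCount (π : Policy G c) (θ : Fin n → Fin c → ℝ) (M : FeasibleConfig G c)
    (T : ℕ) : ℝ :=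
  expect π θ fun ω : Trajectory G c T => (selectionCount M ω : ℝ)

lemma expCount_nonneg (π : Policy G c) {θ : Fin n → Fin c → ℝ} (hθ : θ ∈ paramSet n c)
    (M : FeasibleConfig G c) (T : ℕ) : 0 ≤ expCount π θ M T :=
  expect_nonneg π hθ fun _ => Nat.cast_nonneg _

lemma UniformlyGood.tendsto_expCount_div_rpow {π : Policy G c} (hπ : UniformlyGood π)
    {θ : Fin n → Fin c → ℝ} (hθ : θ ∈ paramSet n c) {N M : FeasibleConfig G c}
    (hN : IsUniqueOptimal θ N) (hM : M ≠ N) {γ : ℝ} (hγ : 0 < γ) :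
    Tendsto (fun T : ℕ => expCount π θ M T / (T : ℝ) ^ γ) atTop (𝓝 0) :=
  (hπ θ hθ N hN M hM γ hγ).tendsto_div_nhds_zero

lemma UniformlyGood.tendsto_expCount_opt_div {π : Policy G c} (hπ : UniformlyGood π)
    {θ : Fin n → Fin c → ℝ} (hθ : θ ∈ paramSet n c) {N : FeasibleConfig G c}
    (hN : IsUniqueOptimal θ N) :
    Tendsto (fun T : ℕ => expCount π θ N T / T) atTop (𝓝 1) := by
  have h1 : Tendsto (fun T : ℕ => 1 - ∑ M ∈ Finset.univ.erase N, expCount π θ M T / (T : ℝ))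
      atTop (𝓝 (1 - ∑ M ∈ (Finset.univ : Finset (FeasibleConfig G c)).erase N, 0)) := by
    refine tendsto_const_nhds.sub (tendsto_finsetSum _ fun M hM => ?_)
    simpa only [Real.rpow_one] using
      hπ.tendsto_expCount_div_rpow hθ hN (Finset.ne_of_mem_erase hM) one_pos
  rw [Finset.sum_const_zero, sub_zero] at h1
  refine h1.congr' ?_
  filter_upwards [eventually_gt_atTop 0] with T hT
  have hT' : (T : ℝ) ≠ 0 := by positivity
  have hs : ∑ M, expCount π θ M T = T := sum_expect_selectionCount π θ T
  rw [← Finset.add_sum_erase _ _ (Finset.mem_univ N)] at hs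
  rw [← Finset.sum_div]
  field_simp
  linarith

/-- The asymptotic information constraint imposed by one alternative. -/
lemma one_le_sum_limit_mul_realKL {π : Policy G c} (hπ : UniformlyGood π)
    {θ lam : Fin n → Fin c → ℝ} (hθ : θ ∈ paramSet n c) (hlam : lam ∈ paramSet n c)
    {N M : FeasibleConfig G c} (hN : IsUniqueOptimal θ N) (hM : IsUniqueOptimal lam M)
    (hne : M ≠ N) (hfix : ∀ i j, N.1 i j = true → lam i j = θ i j)
    (hac : ∀ (Q : FeasibleConfig G c) k, aggProb k Q.1 θ ≠ 0 → aggProb k Q.1 lam ≠ 0)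
    {l : Filter ℕ} [l.NeBot] (hl : l ≤ atTop) {x : FeasibleConfig G c → ℝ}
    (hx : ∀ Q, Q ≠ N → Tendsto (fun T : ℕ => expCount π θ Q T / Real.log T) l (𝓝 (x Q))) :
    1 ≤ ∑ Q ∈ Finset.univ.filter (fun Q => Q ≠ N), x Q * realKL Q.1 θ lam := by
  have hlog : Tendsto (fun T : ℕ => Real.log T) atTop atTop :=
    Real.tendsto_log_atTop.comp tendsto_natCast_atTop_atTop
  have key : ∀ γ : ℝ, 0 < γ →
      1 - γ ≤ ∑ Q ∈ Finset.univ.filter (fun Q => Q ≠ N), x Q * realKL Q.1 θ lam := by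
    intro γ hγ
    have hlhs : Tendsto (fun T : ℕ => (1 - γ) * (expCount π θ N T / T) -
        expCount π lam N T / (T : ℝ) ^ γ * (Real.log T)⁻¹) l (𝓝 ((1 - γ) * 1 - 0 * 0)) :=
      (((hπ.tendsto_expCount_opt_div hθ hN).const_mul _).sub
        ((hπ.tendsto_expCount_div_rpow hlam hM hne.symm hγ).mul
          hlog.inv_tendsto_atTop)).mono_left hl
    have hrhs : Tendsto (fun T : ℕ => ∑ Q ∈ Finset.univ.filter (fun Q => Q ≠ N),
        expCount π θ Q T / Real.log T * realKL Q.1 θ lam) l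
        (𝓝 (∑ Q ∈ Finset.univ.filter (fun Q => Q ≠ N), x Q * realKL Q.1 θ lam)) :=
      tendsto_finsetSum _ fun Q hQ => (hx Q (Finset.mem_filter.1 hQ).2).mul_const _
    rw [mul_one, mul_zero, sub_zero] at hlhs
    refine le_of_tendsto_of_tendsto hlhs hrhs (hl ?_)
    filter_upwards [eventually_gt_atTop 1] with T hT
    have hT0 : (0 : ℝ) < T := by positivity
    have hL : 0 < Real.log T := Real.log_pos (by exact_mod_cast hT)
    have hb := selectionCount_information_bound π hθ hlam hac T N ((1 - γ) * Real.log T)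
    rw [mul_comm (1 - γ) (Real.log T), ← Real.rpow_def_of_pos hT0, Real.rpow_sub hT0,
      Real.rpow_one, ← Finset.sum_filter_add_sum_filter_not Finset.univ (fun Q => Q ≠ N)] at hb
    -- N is played about T times, so its term is harmless only because its divergence vanishes
    -- exactly.
    have hz : ∑ Q ∈ Finset.univ.filter (fun Q => ¬ Q ≠ N),
        expect π θ (fun ω : Trajectory G c T => (selectionCount Q ω : ℝ)) *
          realKL Q.1 θ lam = 0 := Finset.sum_eq_zero fun Q hQ => by
      have hQN : Q = N := by simpa using hQ
      rw [hQN, realKL_eq_zero_of_eq_on N.2 hfix, mul_zero]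
    rw [hz, add_zero] at hb
    have hg : (0 : ℝ) < (T : ℝ) ^ γ := Real.rpow_pos_of_pos hT0 γ
    calc (1 - γ) * (expCount π θ N T / T) - expCount π lam N T / (T : ℝ) ^ γ * (Real.log T)⁻¹
        = (Real.log T * (1 - γ) * (expCount π θ N T / T) -
          (T : ℝ) / (T : ℝ) ^ γ * (expCount π lam N T / T)) / Real.log T := by
          field_simp
      _ ≤ (∑ Q ∈ Finset.univ.filter (fun Q => Q ≠ N),
          expCount π θ Q T * realKL Q.1 θ lam) / Real.log T :=
          div_le_div_of_nonneg_right hb hL.le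
      _ = _ := by
          rw [Finset.sum_div]
          exact Finset.sum_congr rfl fun _ _ => by ring
  refine le_of_forall_pos_le_add fun γ hγ => ?_
  linarith [key γ hγ]

/-- Limit points of the normalized selection counts are admissible weights. -/
lemma mem_admissibleWeights_of_tendsto {π : Policy G c} (hπ : UniformlyGood π)
    {θ : Fin n → Fin c → ℝ} (hθ : θ ∈ paramSet n c) {N : FeasibleConfig G c}
    (hN : IsUniqueOptimal θ N) {l : Filter ℕ} [l.NeBot] (hl : l ≤ atTop)
    {x : FeasibleConfig G c → ℝ} (hx0 : ∀ Q, 0 ≤ x Q)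
    (hx : ∀ Q, Q ≠ N → Tendsto (fun T : ℕ => expCount π θ Q T / Real.log T) l (𝓝 (x Q))) :
    x ∈ admissibleWeights θ N := by
  refine ⟨hx0, fun M _ => le_iInf₂ fun lam hlam => ?_⟩
  by_cases hfin : ∀ Q : FeasibleConfig G c, Q ≠ N → 0 < x Q →
      ∀ k ∈ Finset.range (n + 1), aggProb k Q.1 θ ≠ 0 → aggProb k Q.1 lam ≠ 0
  · have hterm : ∀ Q ∈ Finset.univ.filter (fun Q : FeasibleConfig G c => Q ≠ N),
        (x Q : EReal) * aggKL Q.1 θ lam = ((x Q * realKL Q.1 θ lam : ℝ) : EReal) := by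
      intro Q hQ
      rcases (hx0 Q).eq_or_lt' with h0 | h0
      · simp [h0]
      · rw [aggKL_eq_realKL (hfin Q (Finset.mem_filter.1 hQ).2 h0), EReal.coe_mul]
    rw [Finset.sum_congr rfl hterm, ← EReal.coe_sum_real, ← EReal.coe_one, EReal.coe_le_coe_iff]
    refine ge_of_tendsto (f := fun e => ∑ Q ∈ Finset.univ.filter (fun Q => Q ≠ N),
      x Q * realKL Q.1 θ (perturb N.1 lam e)) (x := 𝓝[>] (0 : ℝ))
      (tendsto_finsetSum _ fun Q hQ => ?_) ?_
    · rcases (hx0 Q).eq_or_lt' with h0 | h0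
      · simp only [h0, zero_mul, tendsto_const_nhds]
      · exact (tendsto_realKL (hfin Q (Finset.mem_filter.1 hQ).2 h0)
          (tendsto_perturb N.1 lam)).const_mul _
    · filter_upwards [eventually_perturb_badSet hθ hN hlam] with e he
      obtain ⟨hmem, hfix, hac, M', hne, hM'⟩ := he
      exact one_le_sum_limit_mul_realKL hπ hθ hmem hN hM' hne hfix hac hl hx
  · push Not at hfin
    obtain ⟨Q, hQN, hQ, k, hk, h1, h2⟩ := hfin
    -- In `EReal` a summand ⊥ would absorb ⊤, so it must be excluded before the sum can be ⊤.
    have hbot : ∀ Q ∈ Finset.univ.filter (fun Q : FeasibleConfig G c => Q ≠ N),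
        (x Q : EReal) * aggKL Q.1 θ lam ≠ ⊥ := by
      intro Q _
      by_cases hf : ∀ k ∈ Finset.range (n + 1), aggProb k Q.1 θ ≠ 0 → aggProb k Q.1 lam ≠ 0
      · rw [aggKL_eq_realKL hf, ← EReal.coe_mul]
        exact EReal.coe_ne_bot _
      · push Not at hf
        obtain ⟨k, hk, h1, h2⟩ := hf
        rw [aggKL_eq_top hk h1 h2]
        rcases (hx0 Q).eq_or_lt' with h0 | h0
        · simp [h0]
        · rw [EReal.coe_mul_top_of_pos h0]
          exact top_ne_bot
    rw [EReal.sum_eq_top hbot (Finset.mem_filter.2 ⟨Finset.mem_univ Q, hQN⟩)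
      (by rw [aggKL_eq_top hk h1 h2, EReal.coe_mul_top_of_pos hQ])]
    exact le_top

/-- Positive gaps turn a regret bound into bounds on all normalized suboptimal counts, so
compactness yields a limiting weight vector of cost at most r. -/
lemma lowerBoundConst_le_of_frequently {π : Policy G c} (hπ : UniformlyGood π)
    {θ : Fin n → Fin c → ℝ} (hθ : θ ∈ paramSet n c) {N : FeasibleConfig G c}
    (hN : IsUniqueOptimal θ N) {r : ℝ}
    (hr : ∃ᶠ T : ℕ in atTop, regret π θ T / Real.log T < r) :
    lowerBoundConst θ N ≤ (r : EReal) := by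
  have hneBot : (atTop ⊓ 𝓟 {T : ℕ | regret π θ T / Real.log T < r}).NeBot :=
    inf_principal_neBot_iff.2 fun U hU => (hr.and_eventually hU).exists.imp fun _ h => ⟨h.2, h.1⟩
  obtain ⟨l, hl⟩ := Ultrafilter.exists_le (atTop ⊓ 𝓟 {T : ℕ | regret π θ T / Real.log T < r})
  have hlr : ∀ᶠ T : ℕ in l, regret π θ T / Real.log T < r :=
    (hl.trans inf_le_right) (mem_principal_self _)
  replace hl : (l : Filter ℕ) ≤ atTop := hl.trans inf_le_left
  -- The coordinate of N is set to 0: its true value T / log T (asymptotically) diverges, while N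
  -- has zero cost and is absent from the constraints.
  let x : ℕ → FeasibleConfig G c → ℝ := fun T Q =>
    if Q = N then 0 else expCount π θ Q T / Real.log T
  have hx0 : ∀ T Q, 0 ≤ x T Q := by
    intro T Q
    simp only [x]
    split_ifs
    · exact le_rfl
    · exact div_nonneg (expCount_nonneg π hθ Q T) (Real.log_natCast_nonneg T)
  have hgap : ∀ Q : FeasibleConfig G c, 0 ≤ optMean G θ - mean Q.1 θ := fun Q =>
    sub_nonneg.2 (mean_le_optMean θ Q)
  have hcost : ∀ T, ∑ Q, x T Q * (optMean G θ - mean Q.1 θ) = regret π θ T / Real.log T := by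
    intro T
    rw [regret_eq, Finset.sum_div]
    refine Finset.sum_congr rfl fun Q _ => ?_
    simp only [x]
    split_ifs with h
    · rw [h, hN.optMean_eq, sub_self]
      simp
    · rw [expCount]
      ring
  let K : Set (FeasibleConfig G c → ℝ) :=
    -- At N the gap is 0, so division by zero makes this factor {0}, as needed.
    Set.pi Set.univ fun Q => Set.Icc 0 (r / (optMean G θ - mean Q.1 θ))
  have hK : IsCompact K := isCompact_univ_pi fun _ => isCompact_Icc
  have hxK : ∀ᶠ T in l, x T ∈ K := by
    filter_upwards [hlr] with T hT Q _
    refine ⟨hx0 T Q, ?_⟩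
    by_cases hQ : Q = N
    · simp [x, hQ, hN.optMean_eq]
    · have hpos : 0 < optMean G θ - mean Q.1 θ := by
        rw [hN.optMean_eq]
        exact sub_pos.2 (hN Q hQ)
      rw [le_div_iff₀ hpos]
      have h1 := Finset.single_le_sum
        (f := fun Q => x T Q * (optMean G θ - mean Q.1 θ))
        (fun Q _ => mul_nonneg (hx0 T Q) (hgap Q)) (Finset.mem_univ Q)
      rw [hcost T] at h1
      exact h1.trans hT.le
  obtain ⟨x', -, hx'⟩ := isCompact_iff_ultrafilter_le_nhds.1 hK (l.map x)
    (le_principal_iff.2 hxK)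
  have hlim : Tendsto x l (𝓝 x') := hx'
  rw [tendsto_pi_nhds] at hlim
  have hadm : x' ∈ admissibleWeights θ N :=
    mem_admissibleWeights_of_tendsto hπ hθ hN hl
      (fun Q => ge_of_tendsto' (hlim Q) fun T => hx0 T Q)
      (fun Q hQ => (hlim Q).congr fun T => by simp only [x, if_neg hQ])
  refine (iInf₂_le x' hadm).trans (EReal.coe_le_coe_iff.2 ?_)
  refine le_of_tendsto (tendsto_finsetSum _ fun Q _ => (hlim Q).mul_const _) ?_
  filter_upwards [hlr] with T hT
  rw [hcost T]
  exact hT.le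

end

end SpectrumBandit

theorem theorem5 (n c : ℕ) (G : SimpleGraph (Fin n))
    (θ : Fin n → Fin c → ℝ) (hθ : θ ∈ SpectrumBandit.paramSet n c)
    (Mstar : SpectrumBandit.FeasibleConfig G c)
    (hMstar : SpectrumBandit.IsUniqueOptimal θ Mstar)
    (π : SpectrumBandit.Policy G c) (hπ : SpectrumBandit.UniformlyGood π) :
    SpectrumBandit.lowerBoundConst θ Mstar ≤
      liminf (fun T : ℕ => ((SpectrumBandit.regret π θ T / Real.log (T : ℝ) : ℝ) : EReal))
        atTop := by
  by_contra! hlt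
  obtain ⟨r, hr, hrC⟩ := EReal.lt_iff_exists_real_btwn.1 hlt
  refine hrC.not_ge (SpectrumBandit.lowerBoundConst_le_of_frequently hπ hθ hMstar ?_)
  exact (frequently_lt_of_liminf_lt isCobounded_ge_of_top hr).mono fun T hT =>
    EReal.coe_lt_coe_iff.1 hT
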